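/- For $x,y\in\mathbb{Z}^3$ let $d_2(x,y)=\bigl(\sum_{i=1}^3 (x_i-y_i)^2\bigr)^{1/2}$, and let $\mathcal{D}=\{d_2(x,y): x,y\in\mathbb{Z}^3\}$ be the set of achievable distances. A code $C\subseteq\mathbb{Z}^3$ is called perfect if there is $\rho>0$ such that for every $z\in\mathbb{Z}^3$ there is exactly one $x\in C$ with $d_2(x,z)\le\rho$. The packing radius of $C$ is the largest $r\in\mathcal{D}$ such that the closed balls $\{z\in\mathbb{Z}^3: d_2(x,z)\le r\}$, $x\in C$, are pairwise disjoint. A perfect code with packing radius $r$ is called $r$-perfect; it is linear if it is an additive subgroup of $\mathbb{Z}^3$. Theorem. If $r>0$ and there is a linear $r$-perfect code in $\mathbb{Z}^3$ in the $\ell_2$ metric, then $r=1$ or $r=\sqrt3$. Both radii occur: the lattice with basis $\{(1,0,2),(0,1,4),(0,0,7)\}$, which is the kernel of the homomorphism $\mathbb{Z}^3\to\mathbb{Z}/7\mathbb{Z}$, $(x,y,z)\mapsto x+2y+3z$, is a $1$-perfect code, and the lattice with basis $\{(3,8,0),(0,3,2),(0,0,3)\}$, which is the kernel of the homomorphism $\mathbb{Z}^3\to\mathbb{Z}/27\mathbb{Z}$,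 $(x,y,z)\mapsto x+3y+9z$, is a $\sqrt3$-perfect code. -/

import Mathlib

namespace PerfectCode

/-- The `ℓ₂` distance between two points of `ℤⁿ`. -/
noncomputable def l2Dist {n : ℕ} (x y : Fin n → ℤ) : ℝ :=
  Real.sqrt (∑ i, ((x i : ℝ) - (y i : ℝ)) ^ 2)

/-- The closed ball in `ℤⁿ` for the `ℓ₂` metric. -/
def l2Ball {n : ℕ} (x : Fin n → ℤ) (r : ℝ) : Set (Fin n → ℤ) :=
  {z | l2Dist x z ≤ r}

/-- The set of distances achieved by pairs of points of `ℤⁿ` in the `ℓ₂` metric. -/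
def distanceSet (n : ℕ) : Set ℝ :=
  {d | ∃ x y : Fin n → ℤ, l2Dist x y = d}

/-- A code `C ⊆ ℤⁿ` is perfect if, for some `ρ > 0`, every point of `ℤⁿ` lies within distance `ρ`
of exactly one codeword. -/
def IsPerfect {n : ℕ} (C : Set (Fin n → ℤ)) : Prop :=
  ∃ ρ : ℝ, 0 < ρ ∧ ∀ z : Fin n → ℤ, ∃! x, x ∈ C ∧ l2Dist x z ≤ ρ

/-- `r` is the packing radius of `C`: the largest achievable distance such that the closed balls of
that radius centred at distinct codewords are disjoint. -/
def IsPackingRadius {n : ℕ} (C : Set (Fin n → ℤ)) (r : ℝ) : Prop :=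
  IsGreatest {ρ : ℝ | ρ ∈ distanceSet n ∧
    ∀ x ∈ C, ∀ y ∈ C, x ≠ y → Disjoint (l2Ball x ρ) (l2Ball y ρ)} r

/-- An `r`-perfect code is a perfect code whose packing radius is `r`. -/
def IsRPerfect {n : ℕ} (C : Set (Fin n → ℤ)) (r : ℝ) : Prop :=
  IsPerfect C ∧ IsPackingRadius C r

/-- The additive homomorphism `ℤ³ → ℤ/mℤ`, `(x, y, z) ↦ a x + b y + c z`. -/
def linHom (m : ℕ) (a b c : ℤ) : (Fin 3 → ℤ) →+ ZMod m where
  toFun v := ((a * v 0 + b * v 1 + c * v 2 : ℤ) : ZMod m)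
  map_zero' := by simp
  map_add' v w := by simp only [Pi.add_apply]; push_cast; ring

/-- The vectors `(1,0,2), (0,1,4), (0,0,7)`. -/
def basisAlpha : Fin 3 → Fin 3 → ℤ := ![![1, 0, 2], ![0, 1, 4], ![0, 0, 7]]

/-- The vectors `(3,8,0), (0,3,2), (0,0,3)`. -/
def basisBeta : Fin 3 → Fin 3 → ℤ := ![![3, 8, 0], ![0, 3, 2], ![0, 0, 3]]

end PerfectCode

/-!
A perfect code is a tiling of `ℤ³` by the balls of radius `√n` centred at its points, with `√n` its
packing radius. For a lattice, tiling bounds the shortest vector `v` from both sides. If `v` were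
too short, rounding `v / 2` suitably would produce a common point of the balls at `0` and `v`, which
gives roughly `2 √n < ‖v‖`; if it were too long, a point near `v / 2`, displaced orthogonally to
`v`, would be uncovered, which gives roughly `‖v‖ ≤ √3 √n`. The two bounds leave only `n ≤ 83`.

For each of these `n` other than `1` and `3`, consider corners of the ball: points just outside
it all of whose neighbours towards `0` lie inside. The ball covering a corner avoids those
neighbours, so its centre has few possible positions, and a finite search over a few corners
shows that each choice of centres produces overlapping balls. For `n = 1` and `n = 3`, the ball is a
system of representatives of `ℤ³` modulo the kernel of a homomorphism to `ℤ/7ℤ` and `ℤ/27ℤ`.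
-/

namespace PerfectCode

theorem exists_sign_sum_sq_le {ι R : Type*} [CommRing R] [LinearOrder R] [IsStrictOrderedRing R]
    (s : Finset ι) (f : ι → R) :
    ∃ ε : ι → ℤˣ, (∑ i ∈ s, ε i • f i) ^ 2 ≤ ∑ i ∈ s, f i ^ 2 := by
  classical
  induction s using Finset.induction_on with
  | empty => exact ⟨1, by simp⟩
  | insert a s ha ih =>
    obtain ⟨ε, hε⟩ := ih
    -- Greedy choice: the new term must not reinforce the sum so far.
    obtain ⟨σ, hσ⟩ : ∃ σ : ℤˣ, (σ • f a) * ∑ i ∈ s, ε i • f i ≤ 0 := by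
      rcases le_total (f a * ∑ i ∈ s, ε i • f i) 0 with h | h
      · exact ⟨1, by simpa using h⟩
      · exact ⟨-1, by simpa using h⟩
    have hσa : (σ • f a) ^ 2 = f a ^ 2 := by
      rcases Int.units_eq_one_or σ with rfl | rfl <;> simp
    refine ⟨Function.update ε a σ, ?_⟩
    have hsum : ∑ i ∈ s, Function.update ε a σ i • f i = ∑ i ∈ s, ε i • f i :=
      Finset.sum_congr rfl fun i hi ↦ by
        rw [Function.update_of_ne (ne_of_mem_of_not_mem hi ha)]
    rw [Finset.sum_insert ha, Finset.sum_insert ha, Function.update_self, hsum]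
    linear_combination 2 * hσ + hσa + hε

section CoveringRadius

variable {E : Type*} [NormedAddCommGroup E] [InnerProductSpace ℝ E]

theorem exists_norm_eq_one_inner_eq_zero (hE : 1 < Module.finrank ℝ E) (v : E) :
    ∃ w : E, ‖w‖ = 1 ∧ inner ℝ v w = 0 := by
  have hspan : (ℝ ∙ v) ≠ ⊤ := fun h ↦ by
    have := finrank_span_le_card (R := ℝ) {v}
    rw [h, finrank_top, Set.toFinset_singleton, Finset.card_singleton] at this
    omega
  have : Nontrivial (ℝ ∙ v)ᗮ :=
    Submodule.nontrivial_iff_ne_bot.2 (mt Submodule.orthogonal_eq_bot_iff.1 hspan)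
  obtain ⟨w, hw⟩ := exists_norm_eq (ℝ ∙ v)ᗮ zero_le_one
  exact ⟨w, hw, Submodule.mem_orthogonal_singleton_iff_inner_right.1 w.2⟩

theorem norm_sq_le_of_forall_exists_norm_sub_le (hE : 1 < Module.finrank ℝ E) {L : AddSubgroup E}
    {R : ℝ} (hR : ∀ p, ∃ u ∈ L, ‖u - p‖ ≤ R) {v : E} (hv : v ∈ L)
    (hmin : ∀ u ∈ L, u ≠ 0 → ‖v‖ ≤ ‖u‖) : ‖v‖ ^ 2 ≤ 3 * R ^ 2 := by
  by_contra! hlt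
  -- Points of `L` other than `0` and `v` are far from `v / 2`, while `0` and `v` are far from the
  -- point `v / 2 + (R / 2) w` with `w` a unit vector orthogonal to `v`.
  obtain ⟨w, hw, hvw⟩ := exists_norm_eq_one_inner_eq_zero hE v
  obtain ⟨u, hu, hup⟩ := hR ((1 / 2 : ℝ) • v + (R / 2) • w)
  have hR₀ : 0 ≤ R := (norm_nonneg _).trans hup
  have hpyth (a : ℝ) : ‖a • v + (R / 2) • w‖ ^ 2 = a ^ 2 * ‖v‖ ^ 2 + R ^ 2 / 4 := by
    rw [norm_add_sq_real, inner_smul_left, inner_smul_right, hvw, norm_smul, norm_smul, hw]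
    simp only [mul_pow, Real.norm_eq_abs, sq_abs]
    ring
  have hu₀ : u ≠ 0 := by
    rintro rfl
    have := hpyth (1 / 2)
    rw [zero_sub, norm_neg] at hup
    nlinarith [norm_nonneg ((1 / 2 : ℝ) • v + (R / 2) • w)]
  have huv : u ≠ v := by
    rintro rfl
    have := hpyth (-1 / 2)
    rw [norm_sub_rev, show (1 / 2 : ℝ) • u + (R / 2) • w - u = (-1 / 2 : ℝ) • u + (R / 2) • w by
      module] at hup
    nlinarith [norm_nonneg ((-1 / 2 : ℝ) • u + (R / 2) • w)]
  have hfar : 3 / 4 * ‖v‖ ^ 2 ≤ ‖u - (1 / 2 : ℝ) • v‖ ^ 2 := by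
    have hu_ge := hmin u hu hu₀
    have huv_ge := hmin (u - v) (L.sub_mem hu hv) (sub_ne_zero.2 huv)
    have hpar := parallelogram_law_with_norm ℝ (u - (1 / 2 : ℝ) • v) ((1 / 2 : ℝ) • v)
    rw [sub_add_cancel, show u - (1 / 2 : ℝ) • v - (1 / 2 : ℝ) • v = u - v by module,
      norm_smul, Real.norm_of_nonneg (by norm_num)] at hpar
    nlinarith [norm_nonneg v]
  have hnear : ‖u - (1 / 2 : ℝ) • v‖ ≤ 3 / 2 * R := by
    calc ‖u - (1 / 2 : ℝ) • v‖
        = ‖(u - ((1 / 2 : ℝ) • v + (R / 2) • w)) + (R / 2) • w‖ := by congr 1; module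
      _ ≤ R + R / 2 := by
        refine norm_add_le_of_le hup ?_
        rw [norm_smul, hw, mul_one, Real.norm_of_nonneg (by positivity)]
      _ = 3 / 2 * R := by ring
  nlinarith [norm_nonneg (u - (1 / 2 : ℝ) • v)]

end CoveringRadius

section NormSq

variable {d : ℕ}

/-- The squared Euclidean norm of an integer vector. -/
def normSq (v : Fin d → ℤ) : ℤ := ∑ i, v i ^ 2

theorem normSq_nonneg (v : Fin d → ℤ) : 0 ≤ normSq v :=
  Finset.sum_nonneg fun i _ ↦ sq_nonneg (v i)

theorem normSq_neg (v : Fin d → ℤ) : normSq (-v) = normSq v := by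
  simp [normSq]

theorem normSq_add (v w : Fin d → ℤ) :
    normSq (v + w) = normSq v + 2 * dotProduct v w + normSq w := by
  simp only [normSq, dotProduct, Pi.add_apply, Finset.mul_sum, ← Finset.sum_add_distrib]
  exact Finset.sum_congr rfl fun i _ ↦ by ring

theorem normSq_smul (a : ℤ) (v : Fin d → ℤ) : normSq (a • v) = a ^ 2 * normSq v := by
  simp [normSq, mul_pow, Finset.mul_sum]

theorem normSq_single (i : Fin d) (a : ℤ) : normSq (Pi.single i a : Fin d → ℤ) = a ^ 2 := by
  simp [normSq, Pi.single_apply, ite_pow]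

theorem normSq_sub_single (v : Fin d → ℤ) (i : Fin d) (a : ℤ) :
    normSq (v - Pi.single i a) = normSq v - 2 * a * v i + a ^ 2 := by
  rw [sub_eq_add_neg, normSq_add, normSq_neg, dotProduct_neg, dotProduct_single, normSq_single]
  ring

end NormSq

/-! ### Perfect codes as tilings -/

section Tilings

variable {d n : ℕ} {r : ℝ}

theorem l2Dist_add_left (c x y : Fin d → ℤ) : l2Dist (c + x) (c + y) = l2Dist x y := by
  simp [l2Dist]

theorem IsRPerfect.existsUnique {C : Set (Fin d → ℤ)} (hC : IsRPerfect C r) (z : Fin d → ℤ) :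
    ∃! x, x ∈ C ∧ l2Dist x z ≤ r := by
  obtain ⟨⟨ρ, -, hρ⟩, ⟨-, hdisj⟩, hmax⟩ := hC
  obtain ⟨x, ⟨hxC, hxz⟩, -⟩ := hρ z
  -- The distance from `z` to its codeword is itself a packing distance, so it is at most `r`.
  have hxr : l2Dist x z ≤ r := by
    refine hmax ⟨⟨x, z, rfl⟩, fun a ha b hb hab ↦ Set.disjoint_left.2 fun w hwa hwb ↦ hab ?_⟩
    exact (hρ w).unique ⟨ha, hwa.trans hxz⟩ ⟨hb, hwb.trans hxz⟩
  refine ⟨x, ⟨hxC, hxr⟩, fun y hy ↦ ?_⟩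
  by_contra hyx
  exact Set.disjoint_left.1 (hdisj y hy.1 x hxC hyx) hy.2 hxr

theorem isRPerfect_of_existsUnique {C : Set (Fin d → ℤ)} (hr : 0 < r) (hrd : r ∈ distanceSet d)
    (hC : ∀ z, ∃! x, x ∈ C ∧ l2Dist x z ≤ r) : IsRPerfect C r := by
  refine ⟨⟨r, hr, hC⟩, ⟨hrd, fun x hx y hy hxy ↦ ?_⟩, ?_⟩
  · exact Set.disjoint_left.2 fun w hwx hwy ↦ hxy ((hC w).unique ⟨hx, hwx⟩ ⟨hy, hwy⟩)
  · rintro _ ⟨⟨x, y, rfl⟩, hdisj⟩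
    by_contra! hlt
    -- A point at distance `l2Dist x y` from a codeword `c` has another codeword closer to it.
    obtain ⟨c, ⟨hcC, -⟩, -⟩ := hC 0
    have hcz : l2Dist c (c - x + y) = l2Dist x y := by
      simpa using l2Dist_add_left (c - x) x y
    obtain ⟨b, ⟨hbC, hbz⟩, -⟩ := hC (c - x + y)
    have hcb : c ≠ b := by rintro rfl; linarith
    exact Set.disjoint_left.1 (hdisj c hcC b hbC hcb) hcz.le (hbz.trans hlt.le)

theorem l2Dist_eq_sqrt_normSq (x y : Fin d → ℤ) : l2Dist x y = √(normSq (x - y)) := by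
  simp [l2Dist, normSq]

theorem l2Dist_le_sqrt_iff {x y : Fin d → ℤ} : l2Dist x y ≤ √n ↔ normSq (x - y) ≤ n := by
  rw [l2Dist_eq_sqrt_normSq, Real.sqrt_le_sqrt_iff n.cast_nonneg]
  exact_mod_cast Iff.rfl

theorem sqrt_normSq_mem_distanceSet (v : Fin d → ℤ) : √(normSq v) ∈ distanceSet d :=
  ⟨v, 0, by rw [l2Dist_eq_sqrt_normSq, sub_zero]⟩

theorem exists_eq_sqrt_of_mem_distanceSet (hr : r ∈ distanceSet d) : ∃ n : ℕ, r = √n := by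
  obtain ⟨x, y, rfl⟩ := hr
  obtain ⟨n, hn⟩ := Int.eq_ofNat_of_zero_le (normSq_nonneg (x - y))
  exact ⟨n, by simp [l2Dist_eq_sqrt_normSq, hn]⟩

/-- The balls of radius `√n` centred at the points of `C` tile `ℤᵈ`. This is the integral form of
perfection: the packing radius of a perfect code is the root of a natural number. -/
def IsBallTiling (n : ℕ) (C : Set (Fin d → ℤ)) : Prop :=
  ∀ z, ∃! x, x ∈ C ∧ normSq (x - z) ≤ n

theorem IsRPerfect.isBallTiling {C : Set (Fin d → ℤ)} (hC : IsRPerfect C √n) :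
    IsBallTiling n C := by
  simpa only [IsBallTiling, l2Dist_le_sqrt_iff] using hC.existsUnique

theorem IsBallTiling.isRPerfect {C : Set (Fin d → ℤ)} (hC : IsBallTiling n C) {v : Fin d → ℤ}
    (hv : normSq v = n) (hn : 0 < n) : IsRPerfect C √n := by
  have hd : √n ∈ distanceSet d := by simpa [hv] using sqrt_normSq_mem_distanceSet v
  refine isRPerfect_of_existsUnique (by positivity) hd ?_
  simpa only [IsBallTiling, l2Dist_le_sqrt_iff] using hC

theorem isBallTiling_ker {A : Type*} [AddGroup A] (φ : (Fin d → ℤ) →+ A)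
    (hφ : Set.BijOn φ {b | normSq b ≤ n} Set.univ) : IsBallTiling n (φ.ker : Set (Fin d → ℤ)) := by
  intro z
  obtain ⟨b, hb, hbz⟩ := hφ.surjOn (Set.mem_univ (-φ z))
  refine ⟨b + z, ⟨by simp [AddMonoidHom.mem_ker, hbz], by simpa using hb⟩, fun x ⟨hx, hxz⟩ ↦ ?_⟩
  refine sub_eq_iff_eq_add.1 (hφ.injOn hxz hb ?_)
  rw [map_sub, AddMonoidHom.mem_ker.1 hx, zero_sub, hbz]

variable {Λ : AddSubgroup (Fin d → ℤ)}

theorem IsBallTiling.eq_zero (hΛ : IsBallTiling n (Λ : Set (Fin d → ℤ))) {v z : Fin d → ℤ}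
    (hv : v ∈ Λ) (hz : normSq z ≤ n) (hvz : normSq (v - z) ≤ n) : v = 0 :=
  (hΛ z).unique ⟨hv, hvz⟩ ⟨Λ.zero_mem, by rwa [zero_sub, normSq_neg]⟩

end Tilings

/-! ### Bounding the radius -/

section Bound

variable {d n : ℕ} {Λ : AddSubgroup (Fin d → ℤ)}

theorem exists_balanced_half (v : Fin d → ℤ) :
    ∃ z, normSq ((2 : ℤ) • z - v) ≤ d ∧ dotProduct v ((2 : ℤ) • z - v) ^ 2 ≤ normSq v := by
  -- `ε` decides which half-integral coordinates of `v / 2` are rounded up, so that the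
  -- contributions to `⟨v, 2 z - v⟩` nearly cancel.
  obtain ⟨ε, hε⟩ := exists_sign_sum_sq_le Finset.univ fun i ↦ v i * (v i % 2)
  refine ⟨fun i ↦ (v i + ε i * (v i % 2)) / 2, ?_⟩
  have hz : (2 : ℤ) • (fun i ↦ (v i + ε i * (v i % 2)) / 2) - v = fun i ↦ ε i * (v i % 2) := by
    funext i
    rcases Int.units_eq_one_or (ε i) with h | h <;> simp [h] <;> omega
  have hparity (i : Fin d) : (v i % 2) ^ 2 ≤ 1 := by
    rcases Int.emod_two_eq (v i) with h | h <;> simp [h]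
  rw [hz]
  constructor
  · calc normSq (fun i ↦ ε i * (v i % 2)) ≤ ∑ _i : Fin d, 1 :=
        Finset.sum_le_sum fun i _ ↦ by
          simpa [mul_pow, ← Units.val_pow_eq_pow_val] using hparity i
      _ = d := by simp
  · calc dotProduct v (fun i ↦ ε i * (v i % 2)) ^ 2 = (∑ i, ε i • (v i * (v i % 2))) ^ 2 := by
          simp only [dotProduct, Units.smul_def, smul_eq_mul]
          congr 1; exact Finset.sum_congr rfl fun i _ ↦ by ring
      _ ≤ ∑ i, (v i * (v i % 2)) ^ 2 := hε
      _ ≤ normSq v := Finset.sum_le_sum fun i _ ↦ by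
          nlinarith [sq_nonneg (v i), hparity i]

theorem IsBallTiling.le_normSq (hΛ : IsBallTiling n (Λ : Set (Fin d → ℤ))) {v : Fin d → ℤ}
    (hv : v ∈ Λ) (hv₀ : v ≠ 0) : 4 * (n + 1) ≤ normSq v + 2 * √(normSq v) + d := by
  by_contra! hlt
  have hhalf {z e : Fin d → ℤ} (hze : (2 : ℤ) • z = v + e) (hed : normSq e ≤ d)
      (hve : dotProduct v e ^ 2 ≤ normSq v) : normSq z ≤ n := by
    have hdot : ((dotProduct v e : ℤ) : ℝ) ≤ √(normSq v) := Real.le_sqrt_of_sq_le (mod_cast hve)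
    have hsq : 4 * normSq z = normSq v + 2 * dotProduct v e + normSq e := by
      rw [← normSq_add, ← hze, normSq_smul]; rfl
    have hlt' : (4 * normSq z : ℝ) < 4 * (n + 1) := by
      have : (4 * normSq z : ℝ) = normSq v + 2 * dotProduct v e + normSq e := mod_cast hsq
      have : (normSq e : ℝ) ≤ d := mod_cast hed
      linarith
    have : 4 * normSq z < 4 * (n + 1) := mod_cast hlt'
    linarith
  -- Both halves of `v` in `v = z + (v - z)` would lie in the ball at `0`.
  obtain ⟨z, hzd, hz⟩ := exists_balanced_half v
  refine hv₀ (hΛ.eq_zero hv (hhalf (z := z) (by module) hzd hz) ?_)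
  exact hhalf (e := -((2 : ℤ) • z - v)) (by module) (by rwa [normSq_neg])
    (by rwa [dotProduct_neg, neg_sq])

/-- The inclusion of `ℤᵈ` in Euclidean space, where midpoints and orthogonal directions of lattice
vectors are available. -/
noncomputable def toEuclidean : (Fin d → ℤ) →+ EuclideanSpace ℝ (Fin d) where
  toFun v := WithLp.toLp 2 fun i ↦ (v i : ℝ)
  map_zero' := by ext; simp
  map_add' v w := by ext; simp

theorem norm_toEuclidean_sq (v : Fin d → ℤ) : ‖toEuclidean v‖ ^ 2 = normSq v := by
  simp [EuclideanSpace.real_norm_sq_eq, toEuclidean, normSq]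

theorem norm_toEuclidean (v : Fin d → ℤ) : ‖toEuclidean v‖ = √(normSq v) := by
  rw [← norm_toEuclidean_sq, Real.sqrt_sq (norm_nonneg _)]

theorem exists_norm_toEuclidean_sub_le (p : EuclideanSpace ℝ (Fin d)) :
    ∃ z, ‖toEuclidean z - p‖ ≤ √d / 2 := by
  refine ⟨fun i ↦ round (p i), ?_⟩
  rw [← Real.sqrt_sq (norm_nonneg _), show √d / 2 = √(d / 4) by
    rw [Real.sqrt_div' _ (by norm_num), show (4 : ℝ) = 2 ^ 2 by norm_num,
      Real.sqrt_sq zero_le_two]]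
  refine Real.sqrt_le_sqrt ?_
  calc ‖toEuclidean (fun i ↦ round (p i)) - p‖ ^ 2 = ∑ i, (round (p i) - p i) ^ 2 := by
        simp [EuclideanSpace.real_norm_sq_eq, toEuclidean]
    _ ≤ ∑ _i : Fin d, (1 / 4 : ℝ) := Finset.sum_le_sum fun i _ ↦ by
        rw [← sq_abs, abs_sub_comm]
        nlinarith [abs_sub_round (p i), abs_nonneg (p i - round (p i))]
    _ = d / 4 := by simp; ring

theorem IsBallTiling.exists_norm_sub_le (hΛ : IsBallTiling n (Λ : Set (Fin d → ℤ)))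
    (p : EuclideanSpace ℝ (Fin d)) : ∃ u ∈ Λ.map toEuclidean, ‖u - p‖ ≤ √n + √d / 2 := by
  obtain ⟨z, hz⟩ := exists_norm_toEuclidean_sub_le p
  obtain ⟨v, ⟨hv, hvz⟩, -⟩ := hΛ z
  refine ⟨toEuclidean v, AddSubgroup.mem_map_of_mem _ hv, ?_⟩
  have hvz' : ‖toEuclidean v - toEuclidean z‖ ≤ √n := by
    rw [← map_sub, norm_toEuclidean]
    exact Real.sqrt_le_sqrt (mod_cast hvz)
  exact norm_sub_le_norm_sub_add_norm_sub _ _ _ |>.trans (add_le_add hvz' hz)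

theorem IsBallTiling.exists_shortest (hΛ : IsBallTiling n (Λ : Set (Fin d → ℤ))) (hd : 0 < d) :
    ∃ v ∈ Λ, v ≠ 0 ∧ ∀ u ∈ Λ, u ≠ 0 → normSq v ≤ normSq u := by
  have hex : ∃ v, v ∈ Λ ∧ v ≠ 0 := by
    obtain ⟨v, ⟨hv, hvz⟩, -⟩ := hΛ (Pi.single ⟨0, hd⟩ (n + 1))
    refine ⟨v, hv, ?_⟩
    rintro rfl
    rw [zero_sub, normSq_neg, normSq_single] at hvz
    nlinarith
  obtain ⟨v, ⟨hv, hv₀⟩, hmin⟩ :=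
    exists_minimalFor_of_wellFoundedLT _ (fun v ↦ (normSq v).toNat) hex
  refine ⟨v, hv, hv₀, fun u hu hu₀ ↦ ?_⟩
  by_contra! hlt
  have hle : (normSq v).toNat ≤ (normSq u).toNat :=
    hmin ⟨hu, hu₀⟩ (Int.toNat_le_toNat hlt.le)
  have := normSq_nonneg u
  omega

theorem IsBallTiling.four_mul_succ_le (hΛ : IsBallTiling n (Λ : Set (Fin d → ℤ))) (hd : 2 ≤ d) :
    (4 * (n + 1) : ℝ) ≤ (√3 * (√n + √d / 2) + 1) ^ 2 + d - 1 := by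
  obtain ⟨v, hv, hv₀, hmin⟩ := hΛ.exists_shortest (by omega)
  have hlong : 4 * (n + 1) ≤ ‖toEuclidean v‖ ^ 2 + 2 * ‖toEuclidean v‖ + d := by
    rw [norm_toEuclidean_sq, norm_toEuclidean]
    exact hΛ.le_normSq hv hv₀
  have hmin' : ∀ u ∈ Λ.map toEuclidean, u ≠ 0 → ‖toEuclidean v‖ ≤ ‖u‖ := by
    rintro _ ⟨u, hu, rfl⟩ hu₀
    rw [norm_toEuclidean, norm_toEuclidean]
    exact Real.sqrt_le_sqrt (mod_cast hmin u hu fun h ↦ hu₀ (by rw [h, map_zero]))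
  have hshort : ‖toEuclidean v‖ ≤ √3 * (√n + √d / 2) := by
    refine le_of_sq_le_sq ?_ (by positivity)
    rw [mul_pow, Real.sq_sqrt zero_le_three]
    exact norm_sq_le_of_forall_exists_norm_sub_le (by rw [finrank_euclideanSpace_fin]; omega)
      hΛ.exists_norm_sub_le (AddSubgroup.mem_map_of_mem _ hv) hmin'
  nlinarith [norm_nonneg (toEuclidean v)]

theorem IsBallTiling.le_eightyThree {Λ : AddSubgroup (Fin 3 → ℤ)}
    (hΛ : IsBallTiling n (Λ : Set (Fin 3 → ℤ))) : n ≤ 83 := by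
  have hbound := hΛ.four_mul_succ_le (by norm_num)
  push_cast at hbound
  by_contra! hn
  have hsqrt : 9.165 ≤ √(n : ℝ) :=
    Real.le_sqrt_of_sq_le (by linarith [show (84 : ℝ) ≤ n from mod_cast hn])
  have hsqrt_three : √3 ≤ 1.7321 := Real.sqrt_le_iff.2 (by norm_num)
  have hn_eq : √(n : ℝ) ^ 2 = n := Real.sq_sqrt n.cast_nonneg
  have hthree : √(3 : ℝ) ^ 2 = 3 := Real.sq_sqrt zero_le_three
  have hquad : √(n : ℝ) * (√n - 5 * √3) ≤ 17 / 4 := by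
    linear_combination hbound + 4 * hn_eq + (√n ^ 2 + √3 * √n + √3 ^ 2 / 4 + 7 / 4) * hthree
  nlinarith

end Bound

/-! ### Corners and the search for a lattice -/

section Corner

variable {d n : ℕ}

/-- A corner of the ball of radius `√n` is a lattice point `z` outside the ball such that moving any
nonzero coordinate of `z` one step towards `0` leads into the ball; such a step changes `normSq z`
by `1 - 2 * |z i|`. Corners seed the search for the lattice: few balls can cover them. -/
def IsCorner (n : ℕ) (z : Fin d → ℤ) : Prop :=
  n < normSq z ∧ ∀ i, z i ≠ 0 → normSq z + 1 ≤ n + 2 * |z i|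

variable {Λ : AddSubgroup (Fin d → ℤ)}

theorem IsBallTiling.outer_of_isCorner (hΛ : IsBallTiling n (Λ : Set (Fin d → ℤ)))
    {v z : Fin d → ℤ} (hz : IsCorner n z) (hv : v ∈ Λ) (hvz : normSq (v - z) ≤ n) {i : Fin d}
    (hi : z i ≠ 0) :
    0 ≤ z i * (v - z) i ∧ n < normSq (v - z) + 2 * |(v - z) i| + 1 := by
  have hv₀ : v ≠ 0 := by
    rintro rfl
    rw [zero_sub, normSq_neg] at hvz
    exact hvz.not_gt hz.1
  have hsign : (z i).sign ^ 2 = 1 := by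
    rcases hi.lt_or_gt with h | h
    · rw [Int.sign_eq_neg_one_of_neg h]; rfl
    · rw [Int.sign_eq_one_of_pos h]; rfl
  -- The neighbour of `z` towards `0` in direction `i` is covered by the ball at `0`, hence not by
  -- the ball at `v`.
  have hnear : normSq (z - Pi.single i (z i).sign) ≤ n := by
    have := hz.2 i hi
    rw [normSq_sub_single, hsign, mul_assoc, Int.sign_mul_self_eq_abs]
    linarith
  have hfar : n < normSq (v - z) + 2 * ((z i).sign * (v - z) i) + 1 := by
    by_contra! hle
    refine hv₀ (hΛ.eq_zero hv hnear ?_)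
    rw [← sub_add, ← sub_neg_eq_add, ← Pi.single_neg, normSq_sub_single, neg_sq, hsign]
    linarith
  have hsign_nonneg : 0 ≤ (z i).sign * (v - z) i := by linarith
  rcases hi.lt_or_gt with h | h
  · rw [Int.sign_eq_neg_one_of_neg h] at hfar hsign_nonneg
    rw [abs_of_nonpos (by linarith)]
    exact ⟨by nlinarith, by linarith⟩
  · rw [Int.sign_eq_one_of_pos h] at hfar hsign_nonneg
    rw [abs_of_nonneg (by linarith)]
    exact ⟨by nlinarith, by linarith⟩

end Corner

section Search

variable {n : ℕ}

/-- Triples as vectors. The search runs on triples because the kernel evaluates them faster than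
functions on `Fin 3`. -/
def toVec : ℤ × ℤ × ℤ →+ (Fin 3 → ℤ) where
  toFun v := ![v.1, v.2.1, v.2.2]
  map_zero' := by ext i; fin_cases i <;> rfl
  map_add' v w := by ext i; fin_cases i <;> rfl

theorem toVec_surjective : Function.Surjective toVec := fun v ↦
  ⟨(v 0, v 1, v 2), by ext i; fin_cases i <;> rfl⟩

theorem toVec_eq_zero {v : ℤ × ℤ × ℤ} : toVec v = 0 ↔ v = 0 := by
  refine ⟨fun h ↦ ?_, fun h ↦ h ▸ map_zero toVec⟩
  exact Prod.ext (congrFun h 0) (Prod.ext (congrFun h 1) (congrFun h 2))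

/-- The sum of three squares, with products that the kernel evaluates on binary literals. -/
def sumSq (a b c : ℕ) : ℕ := a * a + b * b + c * c

/-- The squared Euclidean norm of a triple, as a natural number for fast evaluation. -/
def natNormSq (v : ℤ × ℤ × ℤ) : ℕ := sumSq v.1.natAbs v.2.1.natAbs v.2.2.natAbs

theorem normSq_toVec (v : ℤ × ℤ × ℤ) : normSq (toVec v) = natNormSq v := by
  simp [normSq, toVec, Fin.sum_univ_three, natNormSq, sumSq, ← sq]

/-- The ways to round `v / 2` to a triple `z`, up to exchanging `z` and `v - z`; so the first
coordinate is always rounded down. -/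
def halves (v : ℤ × ℤ × ℤ) : List (ℤ × ℤ × ℤ) :=
  [(v.1 / 2, (v.2.1 + 1) / 2, (v.2.2 + 1) / 2), (v.1 / 2, v.2.1 / 2, (v.2.2 + 1) / 2),
   (v.1 / 2, (v.2.1 + 1) / 2, v.2.2 / 2), (v.1 / 2, v.2.1 / 2, v.2.2 / 2)]

/-- A test certifying that the balls of radius `√n` at `0` and `v` are distinct and meet: it looks
for a common point near the midpoint. -/
def overlap (n : ℕ) (v : ℤ × ℤ × ℤ) : Bool :=
  v ≠ 0 && (halves v).any fun z ↦ natNormSq z ≤ n && natNormSq (v - z) ≤ n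

/-- The computable form of `IsCorner`. -/
def isCorner (n : ℕ) (z : ℤ × ℤ × ℤ) : Bool :=
  n < natNormSq z && [z.1, z.2.1, z.2.2].all fun x ↦ x = 0 || natNormSq z + 1 ≤ n + 2 * x.natAbs

/-- The integers of absolute value at most `m` whose sign does not oppose that of `x`. -/
def steps (m : ℕ) (x : ℤ) : List ℤ :=
  (Int.range (-m) (m + 1)).filter fun a ↦ 0 ≤ x * a

/-- The values of the last coordinate of an outer point when its square is at most `m ^ 2`: if the
corner has last coordinate `x ≠ 0`, outerness forces the absolute value to be maximal. -/
def lastSteps (m : ℕ) (x : ℤ) : List ℤ :=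
  if x = 0 then Int.range (-m) (m + 1) else [x.sign * m]

/-- The ball of radius `√n` contains `u` but not its neighbours away from `0` in those of the first
two directions in which `z` is nonzero. The last direction is taken care of by `lastSteps`. -/
def isOuter (n : ℕ) (z u : ℤ × ℤ × ℤ) : Bool :=
  natNormSq u ≤ n && [(z.1, u.1), (z.2.1, u.2.1)].all fun p ↦
    p.1 = 0 || n < natNormSq u + 2 * p.2.natAbs + 1

/-- The possible positions `u = v - z` of the centre `v` of the ball covering a corner `z`,
according to `IsBallTiling.outer_of_isCorner`. -/
def outerPoints (n : ℕ) (z : ℤ × ℤ × ℤ) : List (ℤ × ℤ × ℤ) :=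
  ((steps n.sqrt z.1).flatMap fun a ↦ (steps n.sqrt z.2.1).flatMap fun b ↦
    (lastSteps (n - sumSq a.natAbs b.natAbs 0).sqrt z.2.2).map fun c ↦ (a, b, c)).filter
      (isOuter n z)

/-- A depth-first search showing that no lattice containing `S` is tiled by the ball of radius `√n`.
The corner `z` is covered by a ball centred at some lattice point `z + u` with `u` an outer point;
either this ball overlaps the ball at a vector of `S`, or `S` grows by its sums and differences
with `z + u`, and the search goes on with the next corner. -/
def refutes (n : ℕ) : List (ℤ × ℤ × ℤ) → List (ℤ × ℤ × ℤ) → Bool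
  | [], _ => false
  | z :: zs, S => isCorner n z && ((outerPoints n z).map (z + ·)).all fun v ↦
      (S.any fun s ↦ overlap n (v - s)) || refutes n zs (S ++ S.map (· + v) ++ S.map (· - v))

theorem mem_steps {m : ℕ} {x a : ℤ} (ha : a.natAbs ≤ m) (hxa : 0 ≤ x * a) : a ∈ steps m x := by
  simp only [steps, List.mem_filter, Int.mem_range_iff, decide_eq_true_eq]
  omega

theorem mem_lastSteps {m : ℕ} {x c : ℤ} (hc : c.natAbs ≤ m)
    (hxc : x ≠ 0 → 0 ≤ x * c ∧ m ≤ c.natAbs) : c ∈ lastSteps m x := by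
  rw [lastSteps]
  split_ifs with hx
  · rw [Int.mem_range_iff]
    omega
  · obtain ⟨hxc, hmc⟩ := hxc hx
    rw [List.mem_singleton]
    rcases lt_or_gt_of_ne hx with h | h
    · have : c ≤ 0 := by nlinarith
      rw [Int.sign_eq_neg_one_of_neg h]
      omega
    · have : 0 ≤ c := by nlinarith
      rw [Int.sign_eq_one_of_pos h]
      omega

theorem mem_outerPoints {z u : ℤ × ℤ × ℤ} (hun : natNormSq u ≤ n)
    (hu : ∀ i, toVec z i ≠ 0 →
      0 ≤ toVec z i * toVec u i ∧ n < natNormSq u + 2 * (toVec u i).natAbs + 1) :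
    u ∈ outerPoints n z := by
  obtain ⟨a, b, c⟩ := u
  simp only [Fin.forall_fin_succ, toVec, AddMonoidHom.coe_mk, ZeroHom.coe_mk, Matrix.cons_val_zero,
    Matrix.cons_val_succ, IsEmpty.forall_iff, and_true] at hu
  obtain ⟨ha, hb, hc⟩ := hu
  have hsum : a.natAbs ^ 2 + b.natAbs ^ 2 + c.natAbs ^ 2 = natNormSq (a, b, c) := by
    simp only [natNormSq, sumSq]; ring
  have hab : n - sumSq a.natAbs b.natAbs 0 = n - (a.natAbs ^ 2 + b.natAbs ^ 2) := by
    simp only [sumSq]; ring_nf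
  have hmem {x y : ℤ} (hy : y.natAbs ^ 2 ≤ n) (hxy : x ≠ 0 → 0 ≤ x * y ∧
      n < natNormSq (a, b, c) + 2 * y.natAbs + 1) : y ∈ steps n.sqrt x := by
    refine mem_steps (Nat.le_sqrt'.2 hy) ?_
    rcases eq_or_ne x 0 with rfl | hx
    · rw [zero_mul]
    · exact (hxy hx).1
  simp only [outerPoints, List.mem_filter, List.mem_flatMap, List.mem_map]
  refine ⟨⟨a, hmem (by omega) ha, b, hmem (by omega) hb, c, ?_, rfl⟩, ?_⟩
  · rw [hab]
    refine mem_lastSteps (Nat.le_sqrt'.2 (by omega)) fun hz ↦ ⟨(hc hz).1, ?_⟩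
    refine Nat.lt_succ_iff.1 (Nat.sqrt_lt'.2 ?_)
    have := (hc hz).2
    rw [Nat.succ_eq_add_one, add_sq]
    omega
  · simp only [isOuter, List.all_cons, List.all_nil, Bool.and_true, Bool.and_eq_true,
      Bool.or_eq_true, decide_eq_true_eq]
    exact ⟨hun, or_iff_not_imp_left.2 fun h ↦ (ha h).2, or_iff_not_imp_left.2 fun h ↦ (hb h).2⟩

theorem isCorner_toVec {z : ℤ × ℤ × ℤ} (hz : isCorner n z) : IsCorner n (toVec z) := by
  simp only [isCorner, List.all_cons, List.all_nil, Bool.and_true, Bool.and_eq_true,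
    Bool.or_eq_true, decide_eq_true_eq] at hz
  refine ⟨by rw [normSq_toVec]; exact_mod_cast hz.1, fun i hi ↦ ?_⟩
  rw [normSq_toVec, Int.abs_eq_natAbs]
  fin_cases i <;> simp only [toVec, AddMonoidHom.coe_mk, ZeroHom.coe_mk, Fin.zero_eta, Fin.mk_one,
    Fin.reduceFinMk, Matrix.cons_val] at hi ⊢ <;> omega

variable {Λ : AddSubgroup (Fin 3 → ℤ)}

theorem IsBallTiling.not_overlap (hΛ : IsBallTiling n (Λ : Set (Fin 3 → ℤ))) {v : ℤ × ℤ × ℤ}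
    (hv : toVec v ∈ Λ) : ¬ overlap n v := by
  intro h
  simp only [overlap, Bool.and_eq_true, decide_eq_true_eq, List.any_eq_true] at h
  obtain ⟨hv₀, z, -, hz, hvz⟩ := h
  refine hv₀ (toVec_eq_zero.1 (hΛ.eq_zero hv (z := toVec z) ?_ ?_))
  · rw [normSq_toVec]; exact_mod_cast hz
  · rw [← map_sub, normSq_toVec]; exact_mod_cast hvz

theorem IsBallTiling.exists_mem_outerPoints (hΛ : IsBallTiling n (Λ : Set (Fin 3 → ℤ)))
    {z : ℤ × ℤ × ℤ} (hz : isCorner n z) : ∃ u ∈ outerPoints n z, toVec (z + u) ∈ Λ := by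
  obtain ⟨v, ⟨hv, hvz⟩, -⟩ := hΛ (toVec z)
  obtain ⟨u, hu⟩ := toVec_surjective (v - toVec z)
  have hvu : v = toVec (z + u) := by rw [map_add, hu, add_sub_cancel]
  refine ⟨u, mem_outerPoints ?_ fun i hi ↦ ?_, hvu ▸ hv⟩
  · rw [← hu, normSq_toVec] at hvz
    exact_mod_cast hvz
  · have houter := hΛ.outer_of_isCorner (isCorner_toVec hz) hv hvz hi
    rw [← hu, normSq_toVec, Int.abs_eq_natAbs] at houter
    exact_mod_cast houter

theorem not_isBallTiling_of_refutes {zs S : List (ℤ × ℤ × ℤ)} (h : refutes n zs S)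
    (hS : ∀ s ∈ S, toVec s ∈ Λ) : ¬ IsBallTiling n (Λ : Set (Fin 3 → ℤ)) := by
  intro hΛ
  induction zs generalizing S with
  | nil => simp [refutes] at h
  | cons z zs ih =>
    simp only [refutes, Bool.and_eq_true, List.all_map, List.all_eq_true, Function.comp_apply,
      Bool.or_eq_true, List.any_eq_true] at h
    obtain ⟨u, hu, hv⟩ := hΛ.exists_mem_outerPoints h.1
    rcases h.2 u hu with ⟨s, hs, hover⟩ | hrec
    · refine hΛ.not_overlap ?_ hover
      rw [map_sub]
      exact Λ.sub_mem hv (hS s hs)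
    · refine ih hrec fun s hs ↦ ?_
      simp only [List.mem_append, List.mem_map] at hs
      rcases hs with (hs | ⟨t, ht, rfl⟩) | ⟨t, ht, rfl⟩
      · exact hS s hs
      · rw [map_add]
        exact Λ.add_mem (hS t ht) hv
      · rw [map_sub]
        exact Λ.sub_mem (hS t ht) hv

/-- Each entry `(ns, zs)` lists values `n ∈ ns` and corners `zs` with which `refutes` rules them
out. The corners were found by a computer search. -/
def certificate : List (List ℕ × List (ℤ × ℤ × ℤ)) :=
  [([2], [(1, 1, 1), (-2, 0, 0), (0, -2, 0), (0, 0, 2)]),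
   ([4], [(0, -1, -2), (-1, 0, -2), (0, 1, -2), (1, 0, -2)]),
   ([5], [(-1, 1, 2), (-2, -1, 1), (-1, -2, -1), (1, -2, 1)]),
   ([6, 7], [(0, 0, -3), (-2, 0, -2), (2, 0, -2)]),
   ([8], [(1, -2, -2), (2, -1, -2), (0, 0, -3), (-1, 2, -2), (-2, 1, -2)]),
   ([9], [(0, -3, 1), (0, -1, 3), (0, -3, -1)]),
   ([10], [(3, 1, 1), (3, -1, 1)]),
   ([11], [(0, 3, -2), (-2, 2, -2), (2, 2, -2)]),
   ([12], [(0, 0, -4), (2, 0, -3), (-2, 0, -3)]),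
   ([13], [(3, 2, 1), (1, 2, 3)]),
   ([14, 15], [(-3, 0, -3), (-3, -2, -2)]),
   ([16], [(4, 0, 1), (4, 0, -1)]),
   ([17], [(4, 1, 1), (4, -1, 1)]),
   ([18, 19], [(0, 2, 4), (0, 4, 2)]),
   ([20], [(4, 2, 1), (2, 4, 1)]),
   ([21], [(0, 4, -3), (-2, 2, -4)]),
   ([22, 23], [(4, 2, 2), (2, 2, 4)]),
   ([24], [(-4, 0, 3), (-3, 3, 3), (-3, -3, 3)]),
   ([25], [(4, 3, 1), (3, 4, -1)]),
   ([26, 27, 28], [(0, 5, 2), (0, 5, -2)]),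
   ([29], [(5, 2, 1), (5, -2, 1)]),
   ([30, 31, 32], [(5, 2, 2), (2, 2, 5)]),
   ([33], [(0, 3, 5), (0, 5, 3)]),
   ([34, 35], [(4, 4, 2), (2, 4, 4)]),
   ([36, 37], [(5, 3, 2), (3, 5, 2)]),
   ([38, 39], [(0, 6, 2), (0, 6, -2)]),
   ([40], [(6, 2, 1), (6, -2, -1)]),
   ([41], [(5, 4, 1), (4, 5, -1)]),
   ([42, 43, 44], [(5, 4, 2), (2, 5, 4)]),
   ([45], [(6, 3, 1), (3, 6, -1)]),
   ([46, 47, 48], [(6, 3, 2), (2, 3, 6)]),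
   ([49], [(0, 7, 1), (0, 7, -1)]),
   ([50], [(7, 1, 1), (7, -1, -1)]),
   ([51, 52, 53], [(5, 5, 2), (5, 5, -2)]),
   ([54, 55, 56], [(7, 2, 2), (7, -2, 2)]),
   ([57, 58], [(5, 5, 3), (3, 5, 5)]),
   ([59, 60, 61], [(7, 3, 2), (3, 7, 2)]),
   ([62, 63, 64], [(6, 5, 2), (2, 5, 6)]),
   ([65], [(8, 1, 1), (8, -1, -1)]),
   ([66, 67, 68], [(7, 4, 2), (4, 7, 2)]),
   ([69, 70, 71], [(8, 2, 2), (8, -2, -2)]),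
   ([72, 73], [(7, 4, 3), (3, 4, 7)]),
   ([74, 75, 76], [(8, 3, 2), (3, 8, 2)]),
   ([77, 78, 79, 80], [(6, 6, 3), (6, 6, -3)]),
   ([81, 82, 83], [(8, 4, 2), (8, 4, -2)])]

theorem refutes_certificate :
    ∀ p ∈ certificate, ∀ m ∈ p.1, refutes m p.2 [0] := by
  decide +kernel

theorem exists_mem_certificate :
    ∀ m < 84, m = 0 ∨ m = 1 ∨ m = 3 ∨ ∃ p ∈ certificate, m ∈ p.1 := by
  decide +kernel

theorem IsBallTiling.eq_one_or_eq_three {Λ : AddSubgroup (Fin 3 → ℤ)}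
    (hΛ : IsBallTiling n (Λ : Set (Fin 3 → ℤ))) (hn : n ≠ 0) : n = 1 ∨ n = 3 := by
  rcases exists_mem_certificate n (Nat.lt_succ_of_le hΛ.le_eightyThree) with
    h | h | h | ⟨p, hp, hnp⟩
  · exact absurd h hn
  · exact .inl h
  · exact .inr h
  · exact absurd hΛ <| not_isBallTiling_of_refutes (refutes_certificate p hp n hnp) <| by
      simp [Λ.zero_mem]

end Search

/-! ### The codes of radius `1` and `√3` -/

section Examples

variable {d n : ℕ}

/-- The lattice points of the ball of radius `√n` as an explicit finite set, which the kernel can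
enumerate. -/
noncomputable def latticeBall (d n : ℕ) : Finset (Fin d → ℤ) :=
  {v ∈ Fintype.piFinset fun _ ↦ Finset.Icc (-n : ℤ) n | normSq v ≤ n}

theorem coe_latticeBall : (latticeBall d n : Set (Fin d → ℤ)) = {v | normSq v ≤ n} := by
  ext v
  simp only [latticeBall, Finset.coe_filter, Fintype.mem_piFinset, Finset.mem_Icc,
    Set.mem_ofPred_eq, and_iff_right_iff_imp]
  intro hv i
  have hvi : v i ^ 2 ≤ normSq v :=
    Finset.single_le_sum (f := fun i ↦ v i ^ 2) (fun i _ ↦ sq_nonneg _) (Finset.mem_univ i)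
  exact abs_le.1 <| (Int.le_self_sq _).trans <| (sq_abs (v i)).trans_le (hvi.trans hv)

theorem isBallTiling_ker_of_image_latticeBall {A : Type*} [AddGroup A] [Fintype A] [DecidableEq A]
    (φ : (Fin d → ℤ) →+ A) (himage : (latticeBall d n).image φ = Finset.univ)
    (hcard : (latticeBall d n).card = Fintype.card A) :
    IsBallTiling n (φ.ker : Set (Fin d → ℤ)) := by
  refine isBallTiling_ker φ ?_
  rw [← coe_latticeBall]
  refine ⟨Set.mapsTo_univ _ _, Finset.injOn_of_card_image_eq ?_, ?_⟩
  · rw [himage, hcard, Finset.card_univ]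
  · rw [Set.SurjOn, ← Finset.coe_image, himage, Finset.coe_univ]

theorem isBallTiling_ker_linHom_seven :
    IsBallTiling 1 ((linHom 7 1 2 3).ker : Set (Fin 3 → ℤ)) :=
  isBallTiling_ker_of_image_latticeBall _ (by decide +kernel) (by decide +kernel)

theorem isBallTiling_ker_linHom_twentySeven :
    IsBallTiling 3 ((linHom 27 1 3 9).ker : Set (Fin 3 → ℤ)) :=
  isBallTiling_ker_of_image_latticeBall _ (by decide +kernel) (by decide +kernel)

theorem linearIndependent_basisAlpha : LinearIndependent ℤ basisAlpha :=
  Matrix.linearIndependent_rows_of_det_ne_zero (A := Matrix.of basisAlpha) <| by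
    rw [Matrix.det_fin_three]
    decide

theorem linearIndependent_basisBeta : LinearIndependent ℤ basisBeta :=
  Matrix.linearIndependent_rows_of_det_ne_zero (A := Matrix.of basisBeta) <| by
    rw [Matrix.det_fin_three]
    decide

theorem mem_ker_linHom {m : ℕ} {a b c : ℤ} {v : Fin 3 → ℤ} :
    v ∈ (linHom m a b c).ker ↔ (m : ℤ) ∣ a * v 0 + b * v 1 + c * v 2 :=
  ZMod.intCast_zmod_eq_zero_iff_dvd _ _

theorem sum_smul_mem_closure_range {M ι : Type*} [AddCommGroup M] [Fintype ι] (b : ι → M)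
    (c : ι → ℤ) : ∑ i, c i • b i ∈ AddSubgroup.closure (Set.range b) :=
  sum_mem fun i _ ↦ zsmul_mem (AddSubgroup.subset_closure (Set.mem_range_self i)) (c i)

theorem closure_range_basisAlpha :
    AddSubgroup.closure (Set.range basisAlpha) = (linHom 7 1 2 3).ker := by
  refine le_antisymm ((AddSubgroup.closure_le _).2 ?_) fun v hv ↦ ?_
  · exact Set.range_subset_iff.2 (by decide : ∀ i, linHom 7 1 2 3 (basisAlpha i) = 0)
  · obtain ⟨k, hk⟩ : (7 : ℤ) ∣ v 2 - 2 * v 0 - 4 * v 1 := by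
      have := mem_ker_linHom.1 hv
      push_cast at this
      omega
    convert sum_smul_mem_closure_range basisAlpha ![v 0, v 1, k] using 1
    ext i
    fin_cases i <;> simp [Fin.sum_univ_three, basisAlpha]
    linarith

theorem closure_range_basisBeta :
    AddSubgroup.closure (Set.range basisBeta) = (linHom 27 1 3 9).ker := by
  refine le_antisymm ((AddSubgroup.closure_le _).2 ?_) fun v hv ↦ ?_
  · exact Set.range_subset_iff.2 (by decide : ∀ i, linHom 27 1 3 9 (basisBeta i) = 0)
  · have hdvd := mem_ker_linHom.1 hv
    push_cast at hdvd
    obtain ⟨p, hp⟩ : (3 : ℤ) ∣ v 0 := by omega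
    obtain ⟨q, hq⟩ : (3 : ℤ) ∣ v 1 - 8 * p := by omega
    obtain ⟨s, hs⟩ : (3 : ℤ) ∣ v 2 - 2 * q := by omega
    convert sum_smul_mem_closure_range basisBeta ![p, q, s] using 1
    ext i
    fin_cases i <;> simp [Fin.sum_univ_three, basisBeta] <;> linarith

end Examples

end PerfectCode

theorem theorem3 :
    (∀ (Λ : AddSubgroup (Fin 3 → ℤ)) (r : ℝ), 0 < r →
      PerfectCode.IsRPerfect (Λ : Set (Fin 3 → ℤ)) r → r = 1 ∨ r = Real.sqrt 3) ∧
    (LinearIndependent ℤ PerfectCode.basisAlpha ∧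
      AddSubgroup.closure (Set.range PerfectCode.basisAlpha)
        = (PerfectCode.linHom 7 1 2 3).ker ∧
      PerfectCode.IsRPerfect
        (AddSubgroup.closure (Set.range PerfectCode.basisAlpha) : Set (Fin 3 → ℤ)) 1) ∧
    (LinearIndependent ℤ PerfectCode.basisBeta ∧
      AddSubgroup.closure (Set.range PerfectCode.basisBeta)
        = (PerfectCode.linHom 27 1 3 9).ker ∧
      PerfectCode.IsRPerfect
        (AddSubgroup.closure (Set.range PerfectCode.basisBeta) : Set (Fin 3 → ℤ))
        (Real.sqrt 3)) := by
  refine ⟨fun Λ r hr hΛ ↦ ?_,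
    ⟨PerfectCode.linearIndependent_basisAlpha, PerfectCode.closure_range_basisAlpha, ?_⟩,
    ⟨PerfectCode.linearIndependent_basisBeta, PerfectCode.closure_range_basisBeta, ?_⟩⟩
  · obtain ⟨n, rfl⟩ := PerfectCode.exists_eq_sqrt_of_mem_distanceSet hΛ.2.1.1
    have hn : n ≠ 0 := by
      rintro rfl
      simp at hr
    rcases hΛ.isBallTiling.eq_one_or_eq_three hn with rfl | rfl
    · exact .inl (by simp)
    · exact .inr (by simp)
  · rw [PerfectCode.closure_range_basisAlpha]
    simpa using PerfectCode.isBallTiling_ker_linHom_seven.isRPerfect (v := ![1, 0, 0])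
      (by decide) one_pos
  · rw [PerfectCode.closure_range_basisBeta]
    simpa using PerfectCode.isBallTiling_ker_linHom_twentySeven.isRPerfect (v := ![1, 1, 1])
      (by decide) three_pos
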